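/- Let $d \geq 1$ and let $S = \{x \in \mathbb{R}^d : |x| = 1\}$ be the unit sphere. For $n \geq 1$ and $A \subseteq \mathbb{R}^n$, the Fourier dimension of $A$ is $$\dim_F(A) = \sup\Big\{0 \leq s \leq n : \sup_{\xi \in \mathbb{R}^n} |\widehat{\mu}(\xi)|^2 |\xi|^s < \infty \text{ for some } \mu \in \mathcal{M}(A)\Big\},$$ where $\mathcal{M}(A)$ is the set of all non-zero finite Borel measures on $\mathbb{R}^n$ with compact support contained in $A$, and $\widehat{\mu}(\xi) = \int e^{-2\pi i x \cdot \xi}\, d\mu(x)$. For $R \subseteq (0,\infty)$ put $RS = \{ r x : r \in R,\ x \in S \} \subseteq \mathbb{R}^d$. Then, for every non-empty compact set $R \subseteq (0,\infty)$ (with $\dim_F(R)$ computed in $\mathbb{R}$), we have $$\dim_F(RS) \geq \dim_F(R) + \dim_F(S) \qquad\text{and}\qquad \dim_F(RS) \geq \dim_F(R) + (d-1).$$ -/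

import Mathlib

open MeasureTheory Set
open scoped Pointwise

noncomputable section

/-- The Fourier transform `μ̂(ξ) = ∫ e^{-2πi⟨x, ξ⟩} dμ(x)` of a measure `μ`. -/
def measureFourier {E : Type*} [NormedAddCommGroup E] [InnerProductSpace ℝ E]
    [MeasurableSpace E] (μ : Measure E) (ξ : E) : ℂ :=
  ∫ x, Complex.exp (-2 * (Real.pi : ℂ) * Complex.I * ((inner ℝ x ξ : ℝ) : ℂ)) ∂μ

/-- The set `𝓜(A)` of all non-zero finite Borel measures whose (topological) support is compact and
contained in `A`. -/
def compactMeasuresOn {E : Type*} [NormedAddCommGroup E] [MeasurableSpace E]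
    (A : Set E) : Set (Measure E) :=
  {μ | IsFiniteMeasure μ ∧ μ ≠ 0 ∧ IsCompact μ.support ∧ μ.support ⊆ A}

/-- The Fourier dimension of a subset `A` of a `d`-dimensional Euclidean space: the supremum of all
`s ∈ [0, d]` for which some `μ ∈ 𝓜(A)` satisfies `sup_ξ |μ̂(ξ)|² |ξ|^s < ∞`. The set of such `s` is
bounded by `d`, and it contains `0` as soon as `A` is non-empty. -/
def fourierDim {E : Type*} [NormedAddCommGroup E] [InnerProductSpace ℝ E]
    [MeasurableSpace E] (A : Set E) : ℝ :=
  sSup {s : ℝ | 0 ≤ s ∧ s ≤ (Module.finrank ℝ E : ℝ) ∧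
    ∃ μ ∈ compactMeasuresOn A,
      BddAbove (range fun ξ : E => ‖measureFourier μ ξ‖ ^ 2 * ‖ξ‖ ^ s)}

end

/-!
Let `σ` be the surface measure of the unit sphere and `m = (d - 1) / 2`. Rotation invariance makes
`σ̂(ξ)` a function `J(|ξ|)` of `|ξ|` alone that solves the Bessel-type equation
`t (J'' + 4π² J) + 2 m J' = 0`. Hence `t ^ m J(t)` solves `u'' = (-4π² + O(t⁻²)) u`, which forces
`t ^ m J(t) = A e^{-2πit} + B e^{2πit} + O(1/t)`.

Given `μ` on `R`, let `ν` be the image of `r ^ m dμ(r) × σ` under `(r, x) ↦ r x`. Integrating the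
asymptotics over `r` gives `|ξ| ^ m ν̂(ξ) = A μ̂(|ξ|) + B μ̂(-|ξ|) + O(1/|ξ|)`, so `ν` gains the
exponent `m` over `μ`; the error is harmless because decay exponents of interest on the line are at
most `1/2`. This is the second inequality.

The first follows from it and `dim_F S ≤ d - 1`. If `μ̂(ξ) = O(|ξ| ^ (-s/2))` with `s < d`, then
integrating `|μ̂|²` against a Gaussian of width `1/δ` shows that `μ × μ` gives mass `O(δ ^ s)` to
the pairs at distance at most `δ`. On the other hand, if `μ` lives on the sphere, whose
`δ`-neighbourhood has volume `O(δ)`, then by Cauchy–Schwarz that mass is at least a multiple of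
`δ ^ (d - 1)`.
-/

open Filter Module Metric Asymptotics Bornology
open scoped Topology Real

section AsymptoticIntegration

lemma exists_norm_le_of_norm_deriv_le_div_sq_mul {E : Type*} [NormedAddCommGroup E]
    [NormedSpace ℝ E] {f f' : ℝ → E} {K : ℝ} (hf : ∀ x, 1 ≤ x → HasDerivAt f (f' x) x)
    (hbound : ∀ x, 1 ≤ x → ‖f' x‖ ≤ K / x ^ 2 * ‖f x‖) :
    ∃ M, ∀ x, 1 ≤ x → ‖f x‖ ≤ M := by
  refine ⟨‖f 1‖ * Real.exp |K|, fun x hx => ?_⟩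
  -- In the variable `y = 1 - 1 / x ∈ [0, 1)` the hypothesis is that of the usual Grönwall lemma.
  let φ : ℝ → ℝ := fun y => (1 - y)⁻¹
  have hφ : ∀ y, y < 1 → HasDerivAt φ (φ y ^ 2) y := fun y hy =>
    (((hasDerivAt_id y).const_sub 1).inv (sub_pos.2 hy).ne').congr_deriv (by simp [φ])
  have one_le_φ : ∀ y ∈ Ico (0 : ℝ) 1, 1 ≤ φ y := fun y hy =>
    (one_le_inv₀ (sub_pos.2 hy.2)).2 (by linarith [hy.1])
  have hfφ : ∀ y ∈ Ico (0 : ℝ) 1, HasDerivAt (f ∘ φ) (φ y ^ 2 • f' (φ y)) y := fun y hy =>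
    (hf _ (one_le_φ y hy)).scomp y (hφ y hy.2)
  have hx0 : 0 < x := one_pos.trans_le hx
  have hx1 : 1 - x⁻¹ < 1 := by linarith [inv_pos.2 hx0]
  have hgronwall := norm_le_gronwallBound_of_norm_deriv_right_le (f := f ∘ φ)
    (f' := fun y => φ y ^ 2 • f' (φ y)) (δ := ‖f 1‖) (K := |K|) (ε := 0) (a := 0) (b := 1 - x⁻¹)
    (fun y hy => (hfφ y ⟨hy.1, hy.2.trans_lt hx1⟩).continuousAt.continuousWithinAt)
    (fun y hy => (hfφ y ⟨hy.1, hy.2.trans hx1⟩).hasDerivWithinAt) (by simp [φ])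
    (fun y hy => by
      have hy1 := one_le_φ y ⟨hy.1, hy.2.trans hx1⟩
      rw [norm_smul, Real.norm_of_nonneg (by positivity), add_zero]
      calc φ y ^ 2 * ‖f' (φ y)‖ ≤ φ y ^ 2 * (K / φ y ^ 2 * ‖f (φ y)‖) := by
            gcongr; exact hbound _ hy1
        _ = K * ‖f (φ y)‖ := by field_simp
        _ ≤ |K| * ‖f (φ y)‖ := by gcongr; exact le_abs_self K)
    (1 - x⁻¹) ⟨sub_nonneg.2 (inv_le_one_of_one_le₀ hx), le_rfl⟩
  have hφx : (f ∘ φ) (1 - x⁻¹) = f x := by simp [φ]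
  rw [hφx, gronwallBound_ε0, sub_zero] at hgronwall
  refine hgronwall.trans ?_
  gcongr
  exact mul_le_of_le_one_right (abs_nonneg K) hx1.le

lemma exists_norm_sub_le_div_of_norm_deriv_le_div_sq {E : Type*} [NormedAddCommGroup E]
    [NormedSpace ℝ E] [CompleteSpace E] {f f' : ℝ → E} {K : ℝ}
    (hf : ∀ x, 1 ≤ x → HasDerivAt f (f' x) x) (hbound : ∀ x, 1 ≤ x → ‖f' x‖ ≤ K / x ^ 2) :
    ∃ L : E, ∀ x, 1 ≤ x → ‖f x - L‖ ≤ K / x := by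
  have hint : ∀ x, 1 ≤ x → IntegrableOn (fun y : ℝ => K * y ^ (-2 : ℝ)) (Ioi x) := fun x hx =>
    (integrableOn_Ioi_rpow_of_lt (by norm_num) (by linarith)).const_mul K
  have hle : ∀ y, 1 ≤ y → ‖f' y‖ ≤ K * y ^ (-2 : ℝ) := fun y hy => by
    rw [Real.rpow_neg (by linarith), Real.rpow_two, ← div_eq_mul_inv]
    exact hbound y hy
  have hle_ae : ∀ x, 1 ≤ x → ∀ᵐ y ∂volume.restrict (Ioi x), ‖f' y‖ ≤ K * y ^ (-2 : ℝ) :=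
    fun x hx => (ae_restrict_mem measurableSet_Ioi).mono fun y hy => hle y (hx.trans hy.le)
  have hf'int : IntegrableOn f' (Ioi 1) := by
    refine (hint 1 le_rfl).mono' ?_ (hle_ae 1 le_rfl)
    refine (aestronglyMeasurable_deriv f _).congr ?_
    filter_upwards [ae_restrict_mem measurableSet_Ioi] with y hy using (hf y hy.le).deriv
  have hlim := tendsto_limUnder_of_hasDerivAt_of_integrableOn_Ioi (fun x hx => hf x hx.le) hf'int
  refine ⟨limUnder atTop f, fun x hx => ?_⟩
  rw [norm_sub_rev, ← integral_Ioi_of_hasDerivAt_of_tendsto' (fun y hy => hf y (hx.trans hy))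
    (hf'int.mono_set (Ioi_subset_Ioi hx)) hlim]
  calc ‖∫ y in Ioi x, f' y‖ ≤ ∫ y in Ioi x, K * y ^ (-2 : ℝ) :=
        norm_integral_le_of_norm_le (hint x hx) (hle_ae x hx)
    _ = K / x := by
        rw [integral_const_mul, integral_Ioi_rpow_of_lt (by norm_num) (by linarith)]
        norm_num [Real.rpow_neg_one, div_eq_mul_inv]

lemma exists_norm_sub_le_div_of_norm_deriv_le_div_sq_mul {E : Type*} [NormedAddCommGroup E]
    [NormedSpace ℝ E] [CompleteSpace E] {f f' : ℝ → E} {K : ℝ}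
    (hf : ∀ x, 1 ≤ x → HasDerivAt f (f' x) x)
    (hbound : ∀ x, 1 ≤ x → ‖f' x‖ ≤ K / x ^ 2 * ‖f x‖) :
    ∃ (L : E) (C : ℝ), ∀ x, 1 ≤ x → ‖f x - L‖ ≤ C / x := by
  obtain ⟨M, hM⟩ := exists_norm_le_of_norm_deriv_le_div_sq_mul hf hbound
  have hle : ∀ x, 1 ≤ x → ‖f' x‖ ≤ |K| * M / x ^ 2 := fun x hx => by
    calc ‖f' x‖ ≤ K / x ^ 2 * ‖f x‖ := hbound x hx
      _ ≤ |K| / x ^ 2 * M := by gcongr; exacts [le_abs_self K, hM x hx]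
      _ = |K| * M / x ^ 2 := by ring
  obtain ⟨L, hL⟩ := exists_norm_sub_le_div_of_norm_deriv_le_div_sq hf hle
  exact ⟨L, _, hL⟩

lemma hasDerivAt_cexp_mul_ofReal (c : ℂ) (x : ℝ) :
    HasDerivAt (fun y : ℝ => Complex.exp (c * y)) (c * Complex.exp (c * x)) x := by
  simpa [mul_comm] using ((hasDerivAt_id (x : ℂ)).const_mul c).cexp.comp_ofReal

lemma norm_cexp_mul_ofReal {c : ℂ} (hc : c.re = 0) (x : ℝ) : ‖Complex.exp (c * x)‖ = 1 := by
  simp [Complex.norm_exp, hc]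

lemma norm_cexp_mul_sub_cexp_neg_mul_le {c : ℂ} (hc : c.re = 0) (x : ℝ) (p : ℂ × ℂ) :
    ‖Complex.exp (c * x) * p.1 - Complex.exp (-c * x) * p.2‖ ≤ 2 * ‖p‖ := by
  refine (norm_sub_le _ _).trans ?_
  rw [norm_mul, norm_mul, norm_cexp_mul_ofReal hc, norm_cexp_mul_ofReal (by simp [hc]), one_mul,
    one_mul, two_mul]
  exact add_le_add (norm_fst_le p) (norm_snd_le p)

lemma hasDerivAt_cexp_mul_deriv_add {u u' : ℝ → ℂ} {c v : ℂ} {x : ℝ}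
    (hu : HasDerivAt u (u' x) x) (hu' : HasDerivAt u' (c ^ 2 * u x + v) x) :
    HasDerivAt (fun y : ℝ => Complex.exp (-c * y) * (u' y + c * u y))
      (Complex.exp (-c * x) * v) x :=
  ((hasDerivAt_cexp_mul_ofReal (-c) x).mul (hu'.add (hu.const_mul c))).congr_deriv (by
    simp only [Pi.add_apply]; ring)

lemma exists_norm_sub_exponentials_le_div {u u' q : ℝ → ℂ} {c : ℂ} {k : ℝ} (hc : c ≠ 0)
    (hc_re : c.re = 0) (hu : ∀ x, 1 ≤ x → HasDerivAt u (u' x) x)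
    (hu' : ∀ x, 1 ≤ x → HasDerivAt u' (c ^ 2 * u x + q x * u x) x)
    (hq : ∀ x, 1 ≤ x → ‖q x‖ ≤ k / x ^ 2) :
    ∃ (A B : ℂ) (C : ℝ), ∀ x : ℝ, 1 ≤ x →
      ‖u x - (A * Complex.exp (c * x) + B * Complex.exp (-c * x))‖ ≤ C / x := by
  -- Variation of parameters: `W` collects the coefficients of `u` and would be constant if `q = 0`.
  let W : ℝ → ℂ × ℂ := fun x =>
    (Complex.exp (-c * x) * (u' x + c * u x), Complex.exp (c * x) * (u' x - c * u x))
  let W' : ℝ → ℂ × ℂ := fun x =>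
    (Complex.exp (-c * x) * (q x * u x), Complex.exp (c * x) * (q x * u x))
  have hexp : ∀ x : ℝ, ‖Complex.exp (c * x)‖ = 1 := norm_cexp_mul_ofReal hc_re
  have hexp_neg : ∀ x : ℝ, ‖Complex.exp (-c * x)‖ = 1 := norm_cexp_mul_ofReal (by simp [hc_re])
  have hW : ∀ x, 1 ≤ x → HasDerivAt W (W' x) x := fun x hx => by
    have hneg := hasDerivAt_cexp_mul_deriv_add (c := -c) (v := q x * u x) (hu x hx)
      (by simpa using hu' x hx)
    simp only [neg_neg, neg_mul c, ← sub_eq_add_neg] at hneg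
    exact (hasDerivAt_cexp_mul_deriv_add (hu x hx) (hu' x hx)).prodMk hneg
  have hu_eq : ∀ x : ℝ, u x =
      (2 * c)⁻¹ * (Complex.exp (c * x) * (W x).1 - Complex.exp (-c * x) * (W x).2) := fun x => by
    have hinv : Complex.exp (c * x) * Complex.exp (-c * x) = 1 := by simp [← Complex.exp_add]
    rw [eq_inv_mul_iff_mul_eq₀ (mul_ne_zero two_ne_zero hc)]
    linear_combination (-2 * c * u x) * hinv
  have hcomb : ∀ (x : ℝ) (p : ℂ × ℂ),
      ‖(2 * c)⁻¹ * (Complex.exp (c * x) * p.1 - Complex.exp (-c * x) * p.2)‖ ≤ ‖c‖⁻¹ * ‖p‖ :=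
    fun x p => by
    calc _ ≤ (2 * ‖c‖)⁻¹ * (2 * ‖p‖) := by
          rw [norm_mul, norm_inv, norm_mul, Complex.norm_two]
          gcongr
          exact norm_cexp_mul_sub_cexp_neg_mul_le hc_re x p
      _ = ‖c‖⁻¹ * ‖p‖ := by ring
  have hW' : ∀ x, 1 ≤ x → ‖W' x‖ ≤ k * ‖c‖⁻¹ / x ^ 2 * ‖W x‖ := fun x hx => by
    calc ‖W' x‖ = ‖q x‖ * ‖u x‖ := by simp only [W', Prod.norm_mk, norm_mul, hexp, hexp_neg,
          one_mul, max_self]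
      _ ≤ k / x ^ 2 * (‖c‖⁻¹ * ‖W x‖) := by
          gcongr
          exacts [(norm_nonneg _).trans (hq x hx), hq x hx, hu_eq x ▸ hcomb x (W x)]
      _ = k * ‖c‖⁻¹ / x ^ 2 * ‖W x‖ := by ring
  obtain ⟨L, C, hL⟩ := exists_norm_sub_le_div_of_norm_deriv_le_div_sq_mul hW hW'
  refine ⟨(2 * c)⁻¹ * L.1, -((2 * c)⁻¹ * L.2), ‖c‖⁻¹ * C, fun x hx => ?_⟩
  calc _ = ‖(2 * c)⁻¹ * (Complex.exp (c * x) * (W x - L).1 -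
          Complex.exp (-c * x) * (W x - L).2)‖ := by
        rw [hu_eq x, Prod.fst_sub, Prod.snd_sub]; ring_nf
    _ ≤ ‖c‖⁻¹ * ‖W x - L‖ := hcomb x _
    _ ≤ ‖c‖⁻¹ * (C / x) := by gcongr; exact hL x hx
    _ = ‖c‖⁻¹ * C / x := by ring

lemma exists_norm_rpow_mul_sub_exponentials_le_div {φ φ' φ'' : ℝ → ℂ} {m : ℝ} {c : ℂ} (hc : c ≠ 0)
    (hc_re : c.re = 0) (hφ : ∀ x, 1 ≤ x → HasDerivAt φ (φ' x) x)
    (hφ' : ∀ x, 1 ≤ x → HasDerivAt φ' (φ'' x) x)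
    (hode : ∀ x : ℝ, 1 ≤ x → x * (φ'' x - c ^ 2 * φ x) + 2 * m * φ' x = 0) :
    ∃ (A B : ℂ) (C : ℝ), ∀ x : ℝ, 1 ≤ x →
      ‖((x ^ m : ℝ) : ℂ) * φ x - (A * Complex.exp (c * x) + B * Complex.exp (-c * x))‖ ≤
        C / x := by
  have hpow : ∀ (p x : ℝ), 1 ≤ x →
      HasDerivAt (fun y : ℝ => ((y ^ p : ℝ) : ℂ)) ((p / x * x ^ p : ℝ) : ℂ) x := fun p x hx => by
    have hx0 : x ≠ 0 := (one_pos.trans_le hx).ne'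
    refine (Real.hasDerivAt_rpow_const (Or.inl hx0)).ofReal_comp.congr_deriv ?_
    rw [Real.rpow_sub_one hx0]
    ring_nf
  refine exists_norm_sub_exponentials_le_div (k := |m * (m - 1)|)
    (u' := fun x => ((x ^ m : ℝ) : ℂ) * (φ' x + ((m * x⁻¹ : ℝ) : ℂ) * φ x))
    (q := fun x => ((m * (m - 1) / x ^ 2 : ℝ) : ℂ)) hc hc_re (fun x hx => ?_) (fun x hx => ?_)
    (fun x _ => by rw [Complex.norm_real, Real.norm_eq_abs, abs_div, abs_of_nonneg (sq_nonneg x)])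
  · refine ((hpow m x hx).mul (hφ x hx)).congr_deriv ?_
    push_cast
    ring
  · have hx0 : x ≠ 0 := (one_pos.trans_le hx).ne'
    have hinv := ((hasDerivAt_inv hx0).const_mul m).ofReal_comp
    refine ((hpow m x hx).mul ((hφ' x hx).add (hinv.mul (hφ x hx)))).congr_deriv ?_
    have hxC : (x : ℂ) ≠ 0 := Complex.ofReal_ne_zero.2 hx0
    have hφ''x : φ'' x = c ^ 2 * φ x - 2 * m / x * φ' x := by
      field_simp
      linear_combination hode x hx
    simp only [Pi.add_apply, Pi.mul_apply]
    rw [hφ''x]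
    push_cast
    field_simp
    ring

end AsymptoticIntegration

section MeasureFourier

variable {E : Type*} [NormedAddCommGroup E] [InnerProductSpace ℝ E] [MeasurableSpace E]

lemma measureFourier_eq_charFun (μ : Measure E) (ξ : E) :
    measureFourier μ ξ = charFun μ (-(2 * π) • ξ) := by
  simp only [measureFourier, charFun_apply, inner_smul_right]
  congr! 3 with x
  push_cast
  ring

lemma norm_measureFourier_le (μ : Measure E) (ξ : E) : ‖measureFourier μ ξ‖ ≤ μ.real univ :=
  measureFourier_eq_charFun μ ξ ▸ norm_charFun_le _

lemma continuous_measureFourier [BorelSpace E] [SecondCountableTopology E] (μ : Measure E)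
    [IsFiniteMeasure μ] : Continuous (measureFourier μ) := by
  simp only [funext (measureFourier_eq_charFun μ)]
  fun_prop

lemma ofReal_norm_sq_measureFourier (μ : Measure E) [IsFiniteMeasure μ] (ξ : E) :
    ((‖measureFourier μ ξ‖ ^ 2 : ℝ) : ℂ) =
      ∫ p : E × E, Complex.exp (2 * π * Complex.I * inner ℝ (p.1 - p.2) ξ) ∂μ.prod μ := by
  have hexp : ∀ p : E × E, Complex.exp (2 * π * Complex.I * inner ℝ (p.1 - p.2) ξ) =
      Complex.exp (inner ℝ p.1 ((2 * π) • ξ) * Complex.I) *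
        Complex.exp (inner ℝ p.2 (-(2 * π) • ξ) * Complex.I) := fun p => by
    rw [← Complex.exp_add]
    simp only [inner_sub_left, inner_smul_right]
    push_cast
    ring_nf
  simp only [hexp]
  rw [integral_prod_mul (fun x => Complex.exp (inner ℝ x ((2 * π) • ξ) * Complex.I))
    (fun x => Complex.exp (inner ℝ x (-(2 * π) • ξ) * Complex.I)), ← charFun_apply,
    ← charFun_apply, measureFourier_eq_charFun, neg_smul, charFun_neg, Complex.mul_conj',
    Complex.norm_conj]
  push_cast
  rfl

lemma bddAbove_norm_sq_measureFourier_mul_rpow_iff {μ : Measure E} [IsFiniteMeasure μ] {s : ℝ}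
    (hs : 0 ≤ s) :
    BddAbove (range fun ξ : E => ‖measureFourier μ ξ‖ ^ 2 * ‖ξ‖ ^ s) ↔
      measureFourier μ =O[cobounded E] fun ξ => ‖ξ‖ ^ (-(s / 2)) := by
  have norm_sq_eq : ∀ ξ : E, (‖ξ‖ ^ (s / 2)) ^ 2 = ‖ξ‖ ^ s := fun ξ => by
    rw [← Real.rpow_mul_natCast (norm_nonneg ξ)]; norm_num
  constructor
  · rintro ⟨C, hC⟩
    refine .of_bound √C ?_
    filter_upwards [eventually_cobounded_le_norm 1] with ξ hξ
    have hξ0 : 0 < ‖ξ‖ := one_pos.trans_le hξ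
    rw [Real.norm_of_nonneg (by positivity), Real.rpow_neg hξ0.le, ← div_eq_mul_inv,
      le_div_iff₀ (by positivity)]
    refine Real.le_sqrt_of_sq_le ?_
    rw [mul_pow, norm_sq_eq]
    exact hC ⟨ξ, rfl⟩
  · intro h
    obtain ⟨C, hC⟩ := h.bound
    obtain ⟨r, -, hr⟩ := hasBasis_cobounded_norm.eventually_iff.1
      (hC.and (eventually_cobounded_le_norm 1))
    refine ⟨max (μ.real univ ^ 2 * |r| ^ s) (C ^ 2), ?_⟩
    rintro _ ⟨ξ, rfl⟩
    rcases le_total r ‖ξ‖ with hξ | hξ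
    · refine le_max_of_le_right ?_
      obtain ⟨hbound, hξ1⟩ := hr hξ
      have hξ0 : 0 < ‖ξ‖ := one_pos.trans_le hξ1
      rw [Real.norm_of_nonneg (by positivity), Real.rpow_neg hξ0.le, ← div_eq_mul_inv,
        le_div_iff₀ (by positivity)] at hbound
      calc ‖measureFourier μ ξ‖ ^ 2 * ‖ξ‖ ^ s
          = (‖measureFourier μ ξ‖ * ‖ξ‖ ^ (s / 2)) ^ 2 := by rw [mul_pow, norm_sq_eq]
        _ ≤ C ^ 2 := by gcongr
    · refine le_max_of_le_left ?_
      have hpow : ‖ξ‖ ^ s ≤ |r| ^ s :=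
        Real.rpow_le_rpow (norm_nonneg ξ) (hξ.trans (le_abs_self r)) hs
      exact mul_le_mul (pow_le_pow_left₀ (norm_nonneg _) (norm_measureFourier_le μ ξ) 2) hpow
        (by positivity) (by positivity)

end MeasureFourier

section CompactMeasuresOn

variable {E : Type*} [NormedAddCommGroup E] [MeasurableSpace E] [HereditarilyLindelofSpace E]

lemma mem_compactMeasuresOn_iff {A : Set E} {μ : Measure E} :
    μ ∈ compactMeasuresOn A ↔
      IsFiniteMeasure μ ∧ μ ≠ 0 ∧ ∃ K, IsCompact K ∧ K ⊆ A ∧ ∀ᵐ x ∂μ, x ∈ K := by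
  refine ⟨fun ⟨hfin, h0, hc, hA⟩ => ⟨hfin, h0, _, hc, hA, Measure.support_mem_ae⟩, ?_⟩
  rintro ⟨hfin, h0, K, hK, hKA, hae⟩
  have hsupp : μ.support ⊆ K := Measure.support_subset_of_isClosed hK.isClosed hae
  exact ⟨hfin, h0, hK.of_isClosed_subset Measure.isClosed_support hsupp, hsupp.trans hKA⟩

lemma dirac_mem_compactMeasuresOn [BorelSpace E] {A : Set E} {x : E} (hx : x ∈ A) :
    Measure.dirac x ∈ compactMeasuresOn A :=
  mem_compactMeasuresOn_iff.2 ⟨inferInstance, IsProbabilityMeasure.ne_zero _, {x},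
    isCompact_singleton, singleton_subset_iff.2 hx, by simp [ae_dirac_eq]⟩

lemma withDensity_mem_compactMeasuresOn [BorelSpace E] {A : Set E} {μ : Measure E}
    (hμ : μ ∈ compactMeasuresOn A) {f : E → ℝ} (hf : Measurable f) (hfA : ContinuousOn f A)
    (hf_pos : ∀ x ∈ A, 0 < f x) :
    μ.withDensity (fun x => ENNReal.ofReal (f x)) ∈ compactMeasuresOn A := by
  obtain ⟨hfin, h0, K, hK, hKA, hae⟩ := mem_compactMeasuresOn_iff.1 hμ
  obtain ⟨C, hC⟩ := hK.exists_bound_of_continuousOn (hfA.mono hKA)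
  have hf_int : Integrable f μ := .of_bound hf.aestronglyMeasurable C (hae.mono hC)
  refine mem_compactMeasuresOn_iff.2 ⟨isFiniteMeasure_withDensity_ofReal hf_int.2, fun h => ?_,
    K, hK, hKA, (withDensity_absolutelyContinuous μ _).ae_le hae⟩
  have hac := withDensity_absolutelyContinuous' hf.ennreal_ofReal.aemeasurable
    (hae.mono fun x hx => (ENNReal.ofReal_pos.2 (hf_pos x (hKA hx))).ne')
  exact h0 (Measure.absolutelyContinuous_zero_iff.1 (h ▸ hac))

end CompactMeasuresOn

section FourierDim

variable {E : Type*} [NormedAddCommGroup E] [InnerProductSpace ℝ E] [MeasurableSpace E]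

lemma le_fourierDim {A : Set E} {μ : Measure E} (hμ : μ ∈ compactMeasuresOn A) {s : ℝ}
    (hs : 0 ≤ s) (hs_le : s ≤ finrank ℝ E)
    (hdecay : measureFourier μ =O[cobounded E] fun ξ => ‖ξ‖ ^ (-(s / 2))) :
    s ≤ fourierDim A :=
  have := hμ.1
  le_csSup ⟨finrank ℝ E, fun _ h => h.2.1⟩
    ⟨hs, hs_le, μ, hμ, (bddAbove_norm_sq_measureFourier_mul_rpow_iff hs).2 hdecay⟩

lemma fourierDim_le [BorelSpace E] [HereditarilyLindelofSpace E] {A : Set E} (hA : A.Nonempty)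
    {b : ℝ} (h : ∀ s : ℝ, 0 ≤ s → s ≤ finrank ℝ E → ∀ μ ∈ compactMeasuresOn A,
      measureFourier μ =O[cobounded E] (fun ξ => ‖ξ‖ ^ (-(s / 2))) → s ≤ b) :
    fourierDim A ≤ b := by
  obtain ⟨x, hx⟩ := hA
  refine csSup_le ⟨0, le_rfl, Nat.cast_nonneg _, _, dirac_mem_compactMeasuresOn hx, ?_⟩ ?_
  · rw [bddAbove_norm_sq_measureFourier_mul_rpow_iff le_rfl]
    exact .of_bound 1 (.of_forall fun ξ => by
      simpa using norm_measureFourier_le (Measure.dirac x) ξ)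
  · rintro s ⟨hs, hs_le, μ, hμ, hdecay⟩
    have := hμ.1
    exact h s hs hs_le μ hμ ((bddAbove_norm_sq_measureFourier_mul_rpow_iff hs).1 hdecay)

end FourierDim

section GaussianEnergy

variable {E : Type*} [NormedAddCommGroup E] [InnerProductSpace ℝ E] [FiniteDimensional ℝ E]
  [MeasurableSpace E] [BorelSpace E]

lemma integrable_exp_neg_sq_mul_norm {b : ℝ} (hb : 0 < b) :
    Integrable fun v : E => Real.exp (-(b * ‖v‖) ^ 2) := by
  refine (GaussianFourier.integrable_cexp_neg_mul_sq_norm_add (V := E) (b := (b : ℂ) ^ 2)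
    (by norm_cast; positivity) 0 0).norm.congr (.of_forall fun v => ?_)
  simp [Complex.norm_exp, ← Complex.ofReal_pow, mul_pow]

lemma integral_cexp_neg_sq_mul_norm_add_inner {δ : ℝ} (hδ : 0 < δ) (w : E) :
    ((√π * δ) ^ finrank ℝ E : ℝ) *
        ∫ v : E, Complex.exp (-(π * δ * ‖v‖ : ℝ) ^ 2 + 2 * π * Complex.I * inner ℝ w v) =
      (Real.exp (-(‖w‖ / δ) ^ 2) : ℂ) := by
  have hpi := Real.pi_pos
  have hb : 0 < (π * δ) ^ 2 := by positivity
  have hgauss := GaussianFourier.integral_cexp_neg_mul_sq_norm_add (V := E)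
    (b := ((π * δ) ^ 2 : ℝ)) (by rwa [Complex.ofReal_re]) (2 * π * Complex.I) w
  have hscale : (√π * δ) ^ finrank ℝ E * (π / (π * δ) ^ 2) ^ ((finrank ℝ E : ℝ) / 2) = 1 := by
    have hinv : π / (π * δ) ^ 2 = ((√π * δ) ^ 2)⁻¹ := by
      rw [mul_pow √π, Real.sq_sqrt hpi.le]
      field_simp
    rw [hinv, Real.inv_rpow (by positivity), ← Real.rpow_natCast_mul (by positivity),
      Nat.cast_ofNat, mul_div_cancel₀ _ two_ne_zero, Real.rpow_natCast]
    exact mul_inv_cancel₀ (by positivity)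
  have hexponent : (2 * π * Complex.I) ^ 2 * (‖w‖ : ℂ) ^ 2 / (4 * ((π * δ) ^ 2 : ℝ)) =
      ((-(‖w‖ / δ) ^ 2 : ℝ) : ℂ) := by
    have hδ_ne : (δ : ℂ) ≠ 0 := Complex.ofReal_ne_zero.2 hδ.ne'
    push_cast
    field_simp
    linear_combination (4 * (‖w‖ : ℂ) ^ 2) * Complex.I_sq
  have hcpow : ((π : ℂ) / ((π * δ) ^ 2 : ℝ)) ^ ((finrank ℝ E : ℂ) / 2) =
      ((π / (π * δ) ^ 2) ^ ((finrank ℝ E : ℝ) / 2) : ℝ) := by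
    rw [Complex.ofReal_cpow (by positivity)]
    push_cast
    rfl
  rw [hexponent, hcpow, ← Complex.ofReal_exp] at hgauss
  have hint : ∀ v : E, Complex.exp (-(π * δ * ‖v‖ : ℝ) ^ 2 + 2 * π * Complex.I * inner ℝ w v) =
      Complex.exp (-((π * δ) ^ 2 : ℝ) * ‖v‖ ^ 2 + 2 * π * Complex.I * inner ℝ w v) := fun v => by
    push_cast
    ring_nf
  simp only [hint, hgauss]
  rw [← mul_assoc, ← Complex.ofReal_mul, hscale, Complex.ofReal_one, one_mul]

lemma integral_gaussian_dist_eq (μ : Measure E) [IsFiniteMeasure μ] {δ : ℝ} (hδ : 0 < δ) :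
    ∫ p : E × E, Real.exp (-(‖p.1 - p.2‖ / δ) ^ 2) ∂μ.prod μ =
      (√π * δ) ^ finrank ℝ E *
        ∫ v, Real.exp (-(π * δ * ‖v‖) ^ 2) * ‖measureFourier μ v‖ ^ 2 := by
  have hpi := Real.pi_pos
  let G : E × E → E → ℂ := fun p v =>
    Complex.exp (-(π * δ * ‖v‖ : ℝ) ^ 2 + 2 * π * Complex.I * inner ℝ (p.1 - p.2) v)
  have norm_G : ∀ p v, ‖G p v‖ = Real.exp (-(π * δ * ‖v‖) ^ 2) := fun p v => by
    simp only [G, Complex.norm_exp, ← Complex.ofReal_pow, ← Complex.ofReal_neg, Complex.add_re,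
      Complex.ofReal_re]
    simp
  have hG : Integrable (Function.uncurry G) ((μ.prod μ).prod volume) := by
    refine ((integrable_const (1 : ℝ)).mul_prod
      (integrable_exp_neg_sq_mul_norm (E := E) (mul_pos hpi hδ))).mono'
      (Continuous.aestronglyMeasurable ?_) (.of_forall fun z => ?_)
    · simp only [G, Function.uncurry_def]
      fun_prop
    · simp only [Function.uncurry_def, norm_G, one_mul, le_refl]
  have hswap := integral_integral_swap hG
  have hfst : ∀ v, ∫ p, G p v ∂μ.prod μ =
      ((Real.exp (-(π * δ * ‖v‖) ^ 2) * ‖measureFourier μ v‖ ^ 2 : ℝ) : ℂ) := fun v => by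
    simp only [G, Complex.exp_add]
    rw [integral_const_mul, ← ofReal_norm_sq_measureFourier]
    push_cast
    rfl
  rw [← Complex.ofReal_inj, Complex.ofReal_mul, ← integral_complex_ofReal,
    ← integral_complex_ofReal]
  simp only [← hfst, ← hswap, ← integral_const_mul, G,
    integral_cexp_neg_sq_mul_norm_add_inner hδ]

lemma integrable_exp_neg_sq_norm_mul_rpow_norm [Nontrivial E] {s : ℝ} (hs : s < finrank ℝ E) :
    Integrable fun v : E => Real.exp (-‖v‖ ^ 2) * ‖v‖ ^ (-s) := by
  rw [integrable_fun_norm_addHaar (E := E) volume (f := fun y => Real.exp (-y ^ 2) * y ^ (-s))]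
  refine (integrableOn_congr_fun (fun y (hy : 0 < y) => ?_) measurableSet_Ioi).1
    (integrableOn_rpow_mul_exp_neg_mul_sq one_pos
      (s := (finrank ℝ E : ℝ) - 1 - s) (by linarith))
  have hd : 1 ≤ finrank ℝ E := finrank_pos
  rw [sub_eq_add_neg _ s, Real.rpow_add hy, smul_eq_mul, ← Nat.cast_one, ← Nat.cast_sub hd,
    Real.rpow_natCast, Nat.cast_one, neg_one_mul]
  ring

lemma exists_integral_gaussian_dist_le {μ : Measure E} [IsFiniteMeasure μ] {s : ℝ}
    (hs : 0 ≤ s) (hs_lt : s < finrank ℝ E)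
    (hdecay : measureFourier μ =O[cobounded E] fun ξ => ‖ξ‖ ^ (-(s / 2))) :
    ∃ C, ∀ δ > 0, ∫ p : E × E, Real.exp (-(‖p.1 - p.2‖ / δ) ^ 2) ∂μ.prod μ ≤ C * δ ^ s := by
  have := nontrivial_of_finrank_pos (R := ℝ) (M := E) (by exact_mod_cast hs.trans_lt hs_lt)
  obtain ⟨M, hM⟩ := (bddAbove_norm_sq_measureFourier_mul_rpow_iff hs).2 hdecay
  let g : E → ℝ := fun v => Real.exp (-‖v‖ ^ 2) * ‖v‖ ^ (-s)
  have hg : Integrable g := integrable_exp_neg_sq_norm_mul_rpow_norm hs_lt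
  refine ⟨√π ^ finrank ℝ E * (M * π ^ s * ((π ^ finrank ℝ E)⁻¹ * ∫ v, g v)), fun δ hδ => ?_⟩
  have hr : 0 < π * δ := mul_pos Real.pi_pos hδ
  have hbound : ∀ᵐ v : E, Real.exp (-(π * δ * ‖v‖) ^ 2) * ‖measureFourier μ v‖ ^ 2 ≤
      M * (π * δ) ^ s * g ((π * δ) • v) := by
    filter_upwards [Measure.ae_ne volume (0 : E)] with v hv
    have hv0 : 0 < ‖v‖ := norm_pos_iff.2 hv
    have hMv : ‖measureFourier μ v‖ ^ 2 ≤ M * ‖v‖ ^ (-s) := by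
      rw [Real.rpow_neg hv0.le, ← div_eq_mul_inv, le_div_iff₀ (by positivity)]
      exact hM ⟨v, rfl⟩
    calc _ ≤ Real.exp (-(π * δ * ‖v‖) ^ 2) * (M * ‖v‖ ^ (-s)) := by gcongr
      _ = _ := by
        simp only [g, norm_smul, Real.norm_of_nonneg hr.le]
        rw [Real.mul_rpow hr.le hv0.le, Real.rpow_neg hr.le]
        field_simp
  have hint : ∫ v : E, Real.exp (-(π * δ * ‖v‖) ^ 2) * ‖measureFourier μ v‖ ^ 2 ≤
      M * (π * δ) ^ s * (((π * δ) ^ finrank ℝ E)⁻¹ * ∫ v, g v) := by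
    rw [← smul_eq_mul _ (∫ v, g v), ← Measure.integral_comp_smul_of_nonneg volume g _ (hR := hr.le),
      ← integral_const_mul]
    exact integral_mono_of_nonneg (.of_forall fun v => by positivity)
      ((hg.comp_smul hr.ne').const_mul _) hbound
  rw [integral_gaussian_dist_eq μ hδ]
  calc _ ≤ (√π * δ) ^ finrank ℝ E *
        (M * (π * δ) ^ s * (((π * δ) ^ finrank ℝ E)⁻¹ * ∫ v, g v)) := by gcongr
    _ = _ := by
      rw [mul_pow, mul_pow, Real.mul_rpow Real.pi_pos.le hδ.le]
      field_simp

lemma exists_measureReal_dist_le_mul_rpow {μ : Measure E} [IsFiniteMeasure μ]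
    {s : ℝ} (hs : 0 ≤ s) (hs_lt : s < finrank ℝ E)
    (hdecay : measureFourier μ =O[cobounded E] fun ξ => ‖ξ‖ ^ (-(s / 2))) :
    ∃ C, ∀ δ > 0, (μ.prod μ).real {p | dist p.1 p.2 ≤ δ} ≤ C * δ ^ s := by
  obtain ⟨C, hC⟩ := exists_integral_gaussian_dist_le hs hs_lt hdecay
  refine ⟨Real.exp 1 * C, fun δ hδ => ?_⟩
  have hint : Integrable (fun p : E × E => Real.exp (-(‖p.1 - p.2‖ / δ) ^ 2)) (μ.prod μ) :=
    .of_bound (Continuous.aestronglyMeasurable (by fun_prop)) 1 (.of_forall fun p => by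
      rw [Real.norm_of_nonneg (Real.exp_nonneg _), Real.exp_le_one_iff, neg_nonpos]
      positivity)
  have hsub : {p : E × E | dist p.1 p.2 ≤ δ} ⊆
      {p | Real.exp (-1) ≤ Real.exp (-(‖p.1 - p.2‖ / δ) ^ 2)} := fun p hp => by
    rw [mem_ofPred_eq, Real.exp_le_exp, neg_le_neg_iff, ← dist_eq_norm]
    exact pow_le_one₀ (by positivity) ((div_le_one hδ).2 hp)
  have hmarkov := mul_meas_ge_le_integral_of_nonneg
    (.of_forall fun p : E × E => Real.exp_nonneg (-(‖p.1 - p.2‖ / δ) ^ 2)) hint (Real.exp (-1))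
  calc (μ.prod μ).real {p | dist p.1 p.2 ≤ δ}
      = Real.exp 1 * (Real.exp (-1) * (μ.prod μ).real {p | dist p.1 p.2 ≤ δ}) := by
        rw [← mul_assoc, ← Real.exp_add, add_neg_cancel, Real.exp_zero, one_mul]
    _ ≤ Real.exp 1 * (C * δ ^ s) := by
        refine mul_le_mul_of_nonneg_left (le_trans ?_ (hmarkov.trans (hC δ hδ)))
          (Real.exp_nonneg 1)
        gcongr
        exact measure_ne_top _ _
    _ = Real.exp 1 * C * δ ^ s := by ring

end GaussianEnergy

section ClosedBalls

variable {X : Type*} [PseudoMetricSpace X]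

lemma prodMk_preimage_dist_le (δ : ℝ) (x : X) :
    Prod.mk x ⁻¹' {p : X × X | dist p.1 p.2 ≤ δ} = closedBall x δ := by
  ext y
  simp [dist_comm]

variable [MeasurableSpace X]

lemma measure_closedBall_eq_zero_of_notMem_cthickening {A : Set X} {μ : Measure X}
    (hμ : ∀ᵐ x ∂μ, x ∈ A) {δ : ℝ} {x : X} (hx : x ∉ cthickening δ A) :
    μ (closedBall x δ) = 0 :=
  measure_mono_null
    (fun y hy hyA => hx (mem_cthickening_of_dist_le x y δ A hyA (mem_closedBall'.1 hy)))
    (ae_iff.1 hμ)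

variable [SecondCountableTopology X] [OpensMeasurableSpace X]

lemma measurableSet_dist_le (δ : ℝ) : MeasurableSet {p : X × X | dist p.1 p.2 ≤ δ} :=
  (isClosed_le continuous_dist continuous_const).measurableSet

lemma measurable_measure_closedBall (μ : Measure X) [SFinite μ] (δ : ℝ) :
    Measurable fun x => μ (closedBall x δ) := by
  simpa only [prodMk_preimage_dist_le] using
    measurable_measure_prodMk_left (ν := μ) (measurableSet_dist_le δ)

lemma lintegral_measure_closedBall (μ ν : Measure X) [SFinite μ] [SFinite ν] (δ : ℝ) :
    ∫⁻ x, μ (closedBall x δ) ∂ν = ∫⁻ y, ν (closedBall y δ) ∂μ := by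
  have hfst := Measure.prod_apply (μ := ν) (ν := μ) (measurableSet_dist_le δ)
  have hsnd := Measure.prod_apply_symm (μ := ν) (ν := μ) (measurableSet_dist_le δ)
  simp only [prodMk_preimage_dist_le] at hfst
  exact hfst.symm.trans hsnd

lemma lintegral_sq_measure_closedBall_le (μ ν : Measure X) [SFinite μ] [SFinite ν] (δ : ℝ) :
    ∫⁻ x, μ (closedBall x δ) ^ 2 ∂ν ≤
      ∫⁻ y, μ (closedBall y (2 * δ)) * ν (closedBall y δ) ∂μ := by
  let μ' : Measure X := μ.withDensity fun y => μ (closedBall y (2 * δ))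
  have sq_le : ∀ x, μ (closedBall x δ) ^ 2 ≤ μ' (closedBall x δ) := fun x => by
    rw [withDensity_apply _ measurableSet_closedBall, sq, ← setLIntegral_const]
    refine setLIntegral_mono (measurable_measure_closedBall μ _) fun y hy => ?_
    refine measure_mono (closedBall_subset_closedBall' ?_)
    linarith [mem_closedBall'.1 hy]
  calc ∫⁻ x, μ (closedBall x δ) ^ 2 ∂ν ≤ ∫⁻ x, μ' (closedBall x δ) ∂ν := lintegral_mono sq_le
    _ = ∫⁻ y, ν (closedBall y δ) ∂μ' := lintegral_measure_closedBall μ' ν δ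
    _ = ∫⁻ y, μ (closedBall y (2 * δ)) * ν (closedBall y δ) ∂μ :=
      lintegral_withDensity_eq_lintegral_mul _ (measurable_measure_closedBall μ _)
        (measurable_measure_closedBall ν _)

end ClosedBalls

lemma sq_setLIntegral_le {α : Type*} [MeasurableSpace α] (μ : Measure α) (s : Set α)
    {f : α → ENNReal} (hf : AEMeasurable f μ) :
    (∫⁻ x in s, f x ∂μ) ^ 2 ≤ μ s * ∫⁻ x, f x ^ 2 ∂μ := by
  have hholder := ENNReal.lintegral_mul_le_Lp_mul_Lq (μ.restrict s) Real.HolderConjugate.two_two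
    (aemeasurable_const (b := 1)) hf.restrict
  have sq_rpow_half : ∀ a : ENNReal, (a ^ (1 / 2 : ℝ)) ^ 2 = a := fun a => by
    rw [← ENNReal.rpow_mul_natCast]; norm_num
  simp only [Pi.mul_apply, one_mul, ENNReal.rpow_two, lintegral_const,
    Measure.restrict_apply_univ] at hholder
  calc (∫⁻ x in s, f x ∂μ) ^ 2
      ≤ (μ s ^ (1 / 2 : ℝ) * (∫⁻ x in s, f x ^ 2 ∂μ) ^ (1 / 2 : ℝ)) ^ 2 := by
        gcongr
        simpa using hholder
    _ = μ s * ∫⁻ x in s, f x ^ 2 ∂μ := by rw [mul_pow, sq_rpow_half, sq_rpow_half]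
    _ ≤ μ s * ∫⁻ x, f x ^ 2 ∂μ := by gcongr; exact Measure.restrict_le_self

section UpperBound

lemma isBigO_norm_rpow_cobounded {F : Type*} [SeminormedAddCommGroup F] {a b : ℝ} (hab : a ≤ b) :
    (fun x : F => ‖x‖ ^ a) =O[cobounded F] fun x => ‖x‖ ^ b := by
  refine .of_bound 1 ?_
  filter_upwards [eventually_cobounded_le_norm 1] with x hx
  rw [one_mul, Real.norm_of_nonneg (by positivity), Real.norm_of_nonneg (by positivity)]
  exact Real.rpow_le_rpow_of_exponent_le hx hab

variable {E : Type*} [NormedAddCommGroup E] [InnerProductSpace ℝ E] [FiniteDimensional ℝ E]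

lemma cthickening_sphere_subset {δ : ℝ} (hδ : 0 ≤ δ) :
    cthickening δ (sphere (0 : E) 1) ⊆ closedBall 0 (1 + δ) \ ball 0 (1 - δ) := by
  rw [(isCompact_sphere 0 1).cthickening_eq_biUnion_closedBall hδ]
  refine iUnion₂_subset fun y hy x hx => ?_
  have hdist := abs_le.1 ((abs_norm_sub_norm_le x y).trans (mem_closedBall_iff_norm.1 hx))
  rw [mem_sphere_zero_iff_norm.1 hy] at hdist
  rw [Set.mem_sdiff, mem_closedBall_zero_iff, mem_ball_zero_iff]
  exact ⟨by linarith [hdist.2], by linarith [hdist.1]⟩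

variable [MeasurableSpace E] [BorelSpace E]

lemma sq_measure_univ_mul_volume_ball_le {A : Set E} {μ : Measure E} [IsFiniteMeasure μ]
    (hμ : ∀ᵐ x ∂μ, x ∈ A) {δ : ℝ} (hδ : 0 < δ) :
    μ univ ^ 2 * volume (closedBall (0 : E) δ) ≤
      volume (cthickening δ A) * (μ.prod μ) {p | dist p.1 p.2 ≤ 2 * δ} := by
  set V := volume (closedBall (0 : E) δ)
  have hV : ∀ x : E, volume (closedBall x δ) = V := fun x => Measure.addHaar_closedBall_center _ x δ
  have hV0 : V ≠ 0 := (measure_closedBall_pos volume 0 hδ).ne'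
  have hV_top : V ≠ ⊤ := measure_closedBall_lt_top.ne
  have hsq : ∫⁻ x : E, μ (closedBall x δ) ^ 2 ≤ (μ.prod μ) {p | dist p.1 p.2 ≤ 2 * δ} * V := by
    refine (lintegral_sq_measure_closedBall_le μ volume δ).trans_eq ?_
    simp only [hV, lintegral_mul_const _ (measurable_measure_closedBall μ (2 * δ)),
      Measure.prod_apply (measurableSet_dist_le _), prodMk_preimage_dist_le]
  have hmass : ∫⁻ x in cthickening δ A, μ (closedBall x δ) = V * μ univ := by
    rw [setLIntegral_eq_of_support_subset, lintegral_measure_closedBall]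
    · simp only [hV, lintegral_const]
    · exact fun x hx => by_contra fun h =>
        hx (measure_closedBall_eq_zero_of_notMem_cthickening hμ h)
  rw [← ENNReal.mul_le_mul_iff_left hV0 hV_top]
  calc μ univ ^ 2 * V * V = (∫⁻ x in cthickening δ A, μ (closedBall x δ)) ^ 2 := by
        rw [hmass]; ring
    _ ≤ volume (cthickening δ A) * ∫⁻ x, μ (closedBall x δ) ^ 2 :=
        sq_setLIntegral_le _ _ (measurable_measure_closedBall μ δ).aemeasurable
    _ ≤ volume (cthickening δ A) * ((μ.prod μ) {p | dist p.1 p.2 ≤ 2 * δ} * V) := by gcongr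
    _ = _ := by ring

lemma sq_measureReal_univ_mul_le {A : Set E} {μ : Measure E} [IsFiniteMeasure μ]
    (hμ : ∀ᵐ x ∂μ, x ∈ A) {δ : ℝ} (hδ : 0 < δ) {V : ℝ} (hV : 0 ≤ V)
    (hvol : volume (cthickening δ A) ≤ ENNReal.ofReal V) :
    μ.real univ ^ 2 * (δ ^ finrank ℝ E * volume.real (ball (0 : E) 1)) ≤
      V * (μ.prod μ).real {p | dist p.1 p.2 ≤ 2 * δ} := by
  have h := (sq_measure_univ_mul_volume_ball_le hμ hδ).trans (mul_le_mul_left hvol _)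
  have hreal := ENNReal.toReal_mono
    (ENNReal.mul_ne_top ENNReal.ofReal_ne_top (measure_ne_top _ _)) h
  simpa only [ENNReal.toReal_mul, ENNReal.toReal_pow, ENNReal.toReal_ofReal hV,
    ENNReal.toReal_ofReal (pow_nonneg hδ.le _),
    Measure.addHaar_closedBall volume (0 : E) hδ.le, measureReal_def] using hreal

lemma fourierDim_le_of_volume_cthickening_le {A : Set E} (hA : A.Nonempty) {m K : ℝ} (hm : 0 ≤ m)
    (hvol : ∀ᶠ δ in 𝓝[>] (0 : ℝ),
      volume (cthickening δ A) ≤ ENNReal.ofReal (K * δ ^ (finrank ℝ E - m))) :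
    fourierDim A ≤ m := by
  refine fourierDim_le hA fun s _ hs_le μ hμ hdecay => ?_
  by_contra! hms
  obtain ⟨hfin, h0, B, -, hBA, hB⟩ := mem_compactMeasuresOn_iff.1 hμ
  obtain ⟨t, hmt, hts⟩ := exists_between hms
  obtain ⟨C, hC⟩ := exists_measureReal_dist_le_mul_rpow (hm.trans hmt.le) (hts.trans_le hs_le)
    (hdecay.trans (isBigO_norm_rpow_cobounded (b := -(t / 2)) (by linarith)))
  let c : ℝ := μ.real univ ^ 2 * volume.real (ball (0 : E) 1)
  have hc : 0 < c := by
    have : NeZero μ := ⟨h0⟩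
    have hμ_pos : 0 < μ.real univ := measureReal_univ_pos
    have : 0 < volume.real (ball (0 : E) 1) :=
      ENNReal.toReal_pos (measure_ball_pos _ _ one_pos).ne' measure_ball_lt_top.ne
    positivity
  have hle : ∀ᶠ δ in 𝓝[>] (0 : ℝ), c ≤ |K| * C * 2 ^ t * δ ^ (t - m) := by
    filter_upwards [hvol, self_mem_nhdsWithin] with δ hδ (hδ0 : 0 < δ)
    have hpow : δ ^ (finrank ℝ E - m) * δ ^ t = δ ^ finrank ℝ E * δ ^ (t - m) := by
      rw [← Real.rpow_natCast, ← Real.rpow_add hδ0, ← Real.rpow_add hδ0]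
      ring_nf
    refine le_of_mul_le_mul_left ?_ (pow_pos hδ0 (finrank ℝ E))
    calc δ ^ finrank ℝ E * c
        = μ.real univ ^ 2 * (δ ^ finrank ℝ E * volume.real (ball (0 : E) 1)) := by ring
      _ ≤ |K| * δ ^ (finrank ℝ E - m) * (μ.prod μ).real {p | dist p.1 p.2 ≤ 2 * δ} :=
          sq_measureReal_univ_mul_le (hB.mono hBA) hδ0 (by positivity)
            (hδ.trans (ENNReal.ofReal_le_ofReal (by gcongr; exact le_abs_self K)))
      _ ≤ |K| * δ ^ (finrank ℝ E - m) * (C * (2 * δ) ^ t) := by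
          gcongr
          exact hC _ (by positivity)
      _ = δ ^ finrank ℝ E * (|K| * C * 2 ^ t * δ ^ (t - m)) := by
          rw [Real.mul_rpow zero_le_two hδ0.le]
          linear_combination |K| * C * 2 ^ t * hpow
  have hlim : Tendsto (fun δ : ℝ => |K| * C * 2 ^ t * δ ^ (t - m)) (𝓝[>] 0) (𝓝 0) := by
    have hpow := (Real.continuousAt_rpow_const 0 (t - m) (.inr (by linarith))).tendsto
    rw [Real.zero_rpow (by linarith)] at hpow
    simpa using (hpow.mono_left nhdsWithin_le_nhds).const_mul (|K| * C * 2 ^ t)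
  exact hc.not_ge (ge_of_tendsto hlim hle)

lemma volume_closedBall_diff_ball_le [Nontrivial E] {δ : ℝ} (hδ : 0 < δ) (hδ1 : δ ≤ 1) :
    volume (closedBall (0 : E) (1 + δ) \ ball 0 (1 - δ)) ≤
      ENNReal.ofReal (2 * finrank ℝ E * 2 ^ finrank ℝ E * δ) * volume (ball (0 : E) 1) := by
  have hδ' : 0 ≤ 1 - δ := sub_nonneg.2 hδ1
  have hsub : ball (0 : E) (1 - δ) ⊆ closedBall 0 (1 + δ) :=
    ball_subset_closedBall.trans (closedBall_subset_closedBall (by linarith))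
  rw [measure_sdiff hsub measurableSet_ball.nullMeasurableSet measure_ball_lt_top.ne,
    Measure.addHaar_closedBall _ _ (by linarith), Measure.addHaar_ball _ _ hδ',
    ← ENNReal.sub_mul fun _ _ => measure_ball_lt_top.ne, ← ENNReal.ofReal_sub _ (by positivity)]
  gcongr
  have hmax : max |1 + δ| |1 - δ| ≤ 2 := by
    rw [abs_of_nonneg hδ', abs_of_nonneg (by positivity)]
    exact max_le (by linarith) (by linarith)
  calc (1 + δ) ^ finrank ℝ E - (1 - δ) ^ finrank ℝ E
      ≤ |1 + δ - (1 - δ)| * finrank ℝ E * max |1 + δ| |1 - δ| ^ (finrank ℝ E - 1) :=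
        (le_abs_self _).trans (abs_pow_sub_pow_le _ _ _)
    _ ≤ (2 * δ) * finrank ℝ E * 2 ^ finrank ℝ E := by
        gcongr ?_ * _ * ?_
        · rw [abs_of_nonneg (by linarith)]; linarith
        · exact (pow_le_pow_left₀ (by positivity) hmax _).trans
            (pow_le_pow_right₀ one_le_two (Nat.sub_le _ _))
    _ = 2 * finrank ℝ E * 2 ^ finrank ℝ E * δ := by ring

lemma fourierDim_sphere_le [Nontrivial E] :
    fourierDim (sphere (0 : E) 1) ≤ finrank ℝ E - 1 := by
  have hd : (1 : ℝ) ≤ finrank ℝ E := mod_cast finrank_pos (R := ℝ) (M := E)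
  refine fourierDim_le_of_volume_cthickening_le (NormedSpace.sphere_nonempty.2 zero_le_one)
    (K := 2 * finrank ℝ E * 2 ^ finrank ℝ E * volume.real (ball (0 : E) 1)) (by linarith) ?_
  filter_upwards [Ioc_mem_nhdsGT one_pos] with δ ⟨hδ, hδ1⟩
  calc volume (cthickening δ (sphere (0 : E) 1))
      ≤ volume (closedBall (0 : E) (1 + δ) \ ball 0 (1 - δ)) :=
        measure_mono (cthickening_sphere_subset hδ.le)
    _ ≤ ENNReal.ofReal (2 * finrank ℝ E * 2 ^ finrank ℝ E * δ) * volume (ball (0 : E) 1) :=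
        volume_closedBall_diff_ball_le hδ hδ1
    _ = _ := by
        rw [sub_sub_cancel, Real.rpow_one, ← ofReal_measureReal measure_ball_lt_top.ne,
          ← ENNReal.ofReal_mul (by positivity)]
        ring_nf

end UpperBound

section SphereMeasure

variable {E : Type*} [NormedAddCommGroup E] [InnerProductSpace ℝ E] [FiniteDimensional ℝ E]
  [MeasurableSpace E] [BorelSpace E]

variable (E) in
/-- The surface measure on the unit sphere of `E`, as a measure on `E`. -/
noncomputable def sphereMeasure : Measure E :=
  (volume : Measure E).toSphere.map Subtype.val

instance : IsFiniteMeasure (sphereMeasure E) := Measure.isFiniteMeasure_map _ _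

lemma sphereMeasure_ne_zero [Nontrivial E] : sphereMeasure E ≠ 0 := by
  rw [sphereMeasure, Ne, Measure.map_eq_zero_iff measurable_subtype_coe.aemeasurable]
  exact Measure.toSphere_ne_zero _

lemma ae_mem_sphere_sphereMeasure : ∀ᵐ x ∂sphereMeasure E, x ∈ sphere (0 : E) 1 :=
  (ae_map_iff measurable_subtype_coe.aemeasurable isClosed_sphere.measurableSet).2
    (.of_forall Subtype.property)

lemma sphereMeasure_apply {s : Set E} (hs : MeasurableSet s) :
    sphereMeasure E s = finrank ℝ E * volume (Ioo (0 : ℝ) 1 • (sphere 0 1 ∩ s)) := by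
  rw [sphereMeasure, Measure.map_apply measurable_subtype_coe hs,
    Measure.toSphere_apply' _ (measurable_subtype_coe hs), Subtype.image_preimage_coe]

lemma measurePreserving_sphereMeasure (L : E ≃ₗᵢ[ℝ] E) :
    MeasurePreserving L (sphereMeasure E) (sphereMeasure E) := by
  refine ⟨L.continuous.measurable, Measure.ext fun s hs => ?_⟩
  have hL : MeasurePreserving L.toHomeomorph.toMeasurableEquiv volume volume := L.measurePreserving
  have hcone : Ioo (0 : ℝ) 1 • (sphere (0 : E) 1 ∩ L ⁻¹' s) =
      L ⁻¹' (Ioo (0 : ℝ) 1 • (sphere 0 1 ∩ s)) := by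
    ext x
    constructor
    · rintro ⟨r, hr, y, ⟨hy, hys⟩, rfl⟩
      exact ⟨r, hr, L y, ⟨by simpa using hy, hys⟩, (L.map_smul r y).symm⟩
    · rintro ⟨r, hr, z, ⟨hz, hzs⟩, hrz⟩
      exact ⟨r, hr, L.symm z, ⟨by simpa using hz, by simpa using hzs⟩,
        L.injective (by simpa using hrz)⟩
  rw [Measure.map_apply L.continuous.measurable hs, sphereMeasure_apply hs,
    sphereMeasure_apply (L.continuous.measurable hs), hcone]
  exact congrArg _ (hL.measure_preimage_equiv _)

end SphereMeasure

section CompactlySupported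

variable {X : Type*} [TopologicalSpace X] [MeasurableSpace X] [OpensMeasurableSpace X]
  {F : Type*} [NormedAddCommGroup F] [SecondCountableTopologyEither X F]
  {μ : Measure X} [IsFiniteMeasure μ] {K : Set X}

lemma integrable_of_continuous_of_ae_mem_isCompact (hK : IsCompact K) (hμ : ∀ᵐ x ∂μ, x ∈ K)
    {f : X → F} (hf : Continuous f) : Integrable f μ := by
  obtain ⟨C, hC⟩ := hK.exists_bound_of_continuousOn hf.continuousOn
  exact .of_bound hf.aestronglyMeasurable C (hμ.mono hC)

lemma hasDerivAt_integral_of_ae_mem_isCompact [NormedSpace ℝ F] (hK : IsCompact K)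
    (hμ : ∀ᵐ x ∂μ, x ∈ K) {f f' : ℝ → X → F} (hf : ∀ t, Continuous (f t))
    (hf' : Continuous (Function.uncurry f'))
    (hderiv : ∀ t x, HasDerivAt (fun s => f s x) (f' t x) t) (t : ℝ) :
    HasDerivAt (fun s => ∫ x, f s x ∂μ) (∫ x, f' t x ∂μ) t := by
  obtain ⟨C, hC⟩ :=
    (isCompact_closedBall t 1 |>.prod hK).exists_bound_of_continuousOn hf'.continuousOn
  exact (hasDerivAt_integral_of_dominated_loc_of_deriv_le (bound := fun _ => C)
    (closedBall_mem_nhds t one_pos) (.of_forall fun s => (hf s).aestronglyMeasurable)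
    (integrable_of_continuous_of_ae_mem_isCompact hK hμ (hf t))
    (hf'.comp (by fun_prop : Continuous fun x => (t, x))).aestronglyMeasurable
    (hμ.mono fun x hx s hs => hC (s, x) ⟨hs, hx⟩) (integrable_const _)
    (.of_forall fun x s _ => hderiv s x)).2

end CompactlySupported

section IsometryInvariant

variable {E : Type*} [NormedAddCommGroup E] [InnerProductSpace ℝ E] [MeasurableSpace E]
  [BorelSpace E] {σ : Measure E}

lemma measureFourier_eq_of_norm_eq (hσ : ∀ L : E ≃ₗᵢ[ℝ] E, MeasurePreserving L σ σ) {v w : E}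
    (hvw : ‖v‖ = ‖w‖) : measureFourier σ v = measureFourier σ w := by
  let L : E ≃ₗᵢ[ℝ] E := (ℝ ∙ (v - w))ᗮ.reflection
  have hL : L v = w := Submodule.reflection_sub hvw
  rw [measureFourier, measureFourier,
    ← (hσ L).integral_comp L.toHomeomorph.measurableEmbedding
      fun x => Complex.exp (-2 * π * Complex.I * inner ℝ x w)]
  simp only [← hL, L.inner_map_map]

lemma integral_inner_mul_cexp_inner_eq_zero
    (hσ : ∀ L : E ≃ₗᵢ[ℝ] E, MeasurePreserving L σ σ) {v w : E} (hvw : inner ℝ w v = 0) (c : ℂ) :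
    ∫ x, inner ℝ x w * Complex.exp (c * inner ℝ x v) ∂σ = 0 := by
  let L : E ≃ₗᵢ[ℝ] E := (ℝ ∙ w)ᗮ.reflection
  have hLw : L w = -w := Submodule.reflection_orthogonalComplement_singleton_eq_neg w
  have hLv : L v = v := Submodule.reflection_mem_subspace_eq_self
    (Submodule.mem_orthogonal_singleton_iff_inner_right.2 hvw)
  have hLL : ∀ x u, inner ℝ (L x) u = inner ℝ x (L u) := fun x u => by
    rw [← L.inner_map_map x, Submodule.reflection_reflection]
  have hneg := (hσ L).integral_comp L.toHomeomorph.measurableEmbedding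
    fun x => (inner ℝ x w : ℂ) * Complex.exp (c * inner ℝ x v)
  simp only [hLL, hLw, hLv, inner_neg_right, Complex.ofReal_neg, neg_mul, integral_neg] at hneg
  exact self_eq_neg.1 hneg.symm

variable [IsFiniteMeasure σ] {K : Set E}

lemma hasDerivAt_integral_inner_pow_mul_cexp (hK : IsCompact K) (hσK : ∀ᵐ x ∂σ, x ∈ K) (c : ℂ)
    (e : E) (k : ℕ) (t : ℝ) :
    HasDerivAt (fun s : ℝ => ∫ x, (inner ℝ x e : ℂ) ^ k * Complex.exp (c * s * inner ℝ x e) ∂σ)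
      (c * ∫ x, (inner ℝ x e : ℂ) ^ (k + 1) * Complex.exp (c * t * inner ℝ x e) ∂σ) t := by
  rw [← integral_const_mul]
  refine hasDerivAt_integral_of_ae_mem_isCompact hK hσK (fun s => by fun_prop)
    (f' := fun s x => c * ((inner ℝ x e : ℂ) ^ (k + 1) * Complex.exp (c * s * inner ℝ x e)))
    (by simp only [Function.uncurry_def]; fun_prop) (fun s x => ?_) t
  refine (((hasDerivAt_cexp_mul_ofReal (c * inner ℝ x e) s).const_mul
    ((inner ℝ x e : ℂ) ^ k)).congr_deriv ?_).congr_of_eventuallyEq (.of_forall fun y => ?_)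
  · ring_nf
  · simp only [mul_right_comm]

lemma integral_sq_inner_mul_cexp_inner (hK : IsCompact K) (hσK : ∀ᵐ x ∂σ, x ∈ K)
    (hσ : ∀ L : E ≃ₗᵢ[ℝ] E, MeasurePreserving L σ σ) {e u : E} (heu : inner ℝ e u = 0)
    (hnorm : ‖e‖ = ‖u‖) (c : ℂ) :
    c * ∫ x, (inner ℝ x u : ℂ) ^ 2 * Complex.exp (c * inner ℝ x e) ∂σ =
      ∫ x, inner ℝ x e * Complex.exp (c * inner ℝ x e) ∂σ := by
  -- Differentiate `∫ ⟪x, u - t e⟫ exp (c ⟪x, e + t u⟫) dσ = 0` at `t = 0`.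
  let f : ℝ → E → ℂ := fun t x =>
    (inner ℝ x u - t * inner ℝ x e) * Complex.exp (c * (inner ℝ x e + t * inner ℝ x u))
  let f' : ℝ → E → ℂ := fun t x =>
    (-inner ℝ x e + (inner ℝ x u - t * inner ℝ x e) * (c * inner ℝ x u)) *
      Complex.exp (c * (inner ℝ x e + t * inner ℝ x u))
  have hf : ∀ t, ∫ x, f t x ∂σ = 0 := fun t => by
    have horth : inner ℝ (u - t • e) (e + t • u) = 0 := by
      simp only [inner_sub_left, inner_add_right, real_inner_smul_right,
        real_inner_self_eq_norm_sq, real_inner_comm, heu, hnorm]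
      ring
    have := integral_inner_mul_cexp_inner_eq_zero hσ horth c
    simpa only [f, inner_sub_right, inner_add_right, real_inner_smul_right, Complex.ofReal_sub,
      Complex.ofReal_add, Complex.ofReal_mul] using this
  have hderiv : ∀ t x, HasDerivAt (fun s => f s x) (f' t x) t := fun t x => by
    have hid : HasDerivAt (fun s : ℝ => (s : ℂ)) 1 t := (hasDerivAt_id t).ofReal_comp
    have hexp := (((hid.mul_const (inner ℝ x u : ℂ)).const_add
      (inner ℝ x e : ℂ)).const_mul c).cexp
    refine (((hid.mul_const (inner ℝ x e : ℂ)).const_sub (inner ℝ x u : ℂ)).mul hexp).congr_deriv ?_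
    simp only [f']
    ring
  have hzero := hasDerivAt_integral_of_ae_mem_isCompact hK hσK (fun s => by fun_prop)
    (by simp only [f', Function.uncurry_def]; fun_prop) hderiv 0
  simp only [hf] at hzero
  have hsplit : ∀ x, f' 0 x = c * ((inner ℝ x u : ℂ) ^ 2 * Complex.exp (c * inner ℝ x e)) -
      inner ℝ x e * Complex.exp (c * inner ℝ x e) := fun x => by
    simp only [f', Complex.ofReal_zero, zero_mul, sub_zero, add_zero]
    ring
  rw [← sub_eq_zero, ← hzero.unique (hasDerivAt_const 0 0), ← integral_const_mul, ← integral_sub]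
  · simp only [hsplit]
  all_goals exact integrable_of_continuous_of_ae_mem_isCompact hK hσK (by fun_prop)

lemma integral_sphere_bessel_identity {ι : Type*} [Fintype ι] (b : OrthonormalBasis ι ℝ E)
    (hσ : ∀ L : E ≃ₗᵢ[ℝ] E, MeasurePreserving L σ σ) (hsphere : ∀ᵐ x ∂σ, x ∈ sphere (0 : E) 1)
    (i : ι) (c : ℂ) :
    c * ((∫ x, (inner ℝ x (b i) : ℂ) ^ 2 * Complex.exp (c * inner ℝ x (b i)) ∂σ) -
      ∫ x, Complex.exp (c * inner ℝ x (b i)) ∂σ) +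
      (Fintype.card ι - 1) * ∫ x, inner ℝ x (b i) * Complex.exp (c * inner ℝ x (b i)) ∂σ = 0 := by
  classical
  have := b.toBasis.finiteDimensional_of_finite
  have hint : ∀ f : E → ℂ, Continuous f → Integrable f σ := fun f hf =>
    integrable_of_continuous_of_ae_mem_isCompact (isCompact_sphere 0 1) hsphere hf
  have hsq : ∫ x, Complex.exp (c * inner ℝ x (b i)) ∂σ =
      ∑ j, ∫ x, (inner ℝ x (b j) : ℂ) ^ 2 * Complex.exp (c * inner ℝ x (b i)) ∂σ := by
    rw [← integral_finsetSum _ fun j _ => hint _ (by fun_prop)]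
    refine integral_congr_ae (hsphere.mono fun x hx => ?_)
    have hnorm : ∑ j, (inner ℝ x (b j) : ℂ) ^ 2 = 1 := by
      have hparseval := b.sum_sq_inner_left x
      rw [mem_sphere_zero_iff_norm.1 hx, one_pow] at hparseval
      exact_mod_cast hparseval
    simp only [← Finset.sum_mul, hnorm, one_mul]
  have hoff : ∀ j ∈ Finset.univ.erase i,
      c * ∫ x, (inner ℝ x (b j) : ℂ) ^ 2 * Complex.exp (c * inner ℝ x (b i)) ∂σ =
        ∫ x, inner ℝ x (b i) * Complex.exp (c * inner ℝ x (b i)) ∂σ := fun j hj =>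
    integral_sq_inner_mul_cexp_inner (isCompact_sphere 0 1) hsphere hσ
      (b.inner_eq_zero (Finset.ne_of_mem_erase hj).symm) (by simp) c
  have hsum := Finset.sum_congr rfl hoff
  rw [← Finset.mul_sum, Finset.sum_const, Finset.card_erase_of_mem (Finset.mem_univ i),
    Finset.card_univ, nsmul_eq_mul, Nat.cast_pred (Fintype.card_pos_iff.2 ⟨i⟩)] at hsum
  rw [hsq, ← Finset.add_sum_erase _ _ (Finset.mem_univ i), ← hsum]
  ring

lemma exists_norm_rpow_mul_measureFourier_sub_exponentials_le_div [FiniteDimensional ℝ E]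
    [Nontrivial E] (hσ : ∀ L : E ≃ₗᵢ[ℝ] E, MeasurePreserving L σ σ)
    (hsphere : ∀ᵐ x ∂σ, x ∈ sphere (0 : E) 1) :
    ∃ (A B : ℂ) (C : ℝ), ∀ ξ : E, 1 ≤ ‖ξ‖ →
      ‖((‖ξ‖ ^ (((finrank ℝ E : ℝ) - 1) / 2) : ℝ) : ℂ) * measureFourier σ ξ -
        (A * Complex.exp (-2 * π * Complex.I * ‖ξ‖) +
          B * Complex.exp (2 * π * Complex.I * ‖ξ‖))‖ ≤ C / ‖ξ‖ := by
  let b := stdOrthonormalBasis ℝ E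
  let i : Fin (finrank ℝ E) := ⟨0, finrank_pos⟩
  let c : ℂ := -2 * π * Complex.I
  let J : ℕ → ℝ → ℂ := fun k t =>
    ∫ x, (inner ℝ x (b i) : ℂ) ^ k * Complex.exp (c * t * inner ℝ x (b i)) ∂σ
  have hJ : ∀ k t, HasDerivAt (J k) (c * J (k + 1) t) t :=
    hasDerivAt_integral_inner_pow_mul_cexp (isCompact_sphere 0 1) hsphere c (b i)
  have hJ0 : ∀ ξ, measureFourier σ ξ = J 0 ‖ξ‖ := fun ξ => by
    rw [measureFourier_eq_of_norm_eq hσ (w := ‖ξ‖ • b i) (by simp [norm_smul])]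
    simp only [measureFourier, J, c, pow_zero, one_mul, real_inner_smul_right, Complex.ofReal_mul,
      mul_assoc]
  have hode : ∀ t : ℝ, t * (c * (c * J 2 t) - c ^ 2 * J 0 t) +
      2 * ((((finrank ℝ E : ℝ) - 1) / 2 : ℝ) : ℂ) * (c * J 1 t) = 0 := fun t => by
    have h := integral_sphere_bessel_identity b hσ hsphere i (c * t)
    simp only [J, pow_zero, pow_one, one_mul]
    rw [Fintype.card_fin] at h
    push_cast
    linear_combination c * h
  have hc : c ≠ 0 := by simp [c, Real.pi_ne_zero]
  obtain ⟨A, B, C, hABC⟩ := exists_norm_rpow_mul_sub_exponentials_le_div hc (by simp [c])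
    (fun t _ => hJ 0 t) (fun t _ => (hJ 1 t).const_mul c) fun t _ => hode t
  refine ⟨A, B, C, fun ξ hξ => ?_⟩
  rw [hJ0]
  simpa only [c, neg_mul, neg_neg] using hABC ‖ξ‖ hξ

end IsometryInvariant

section RadialMeasure

variable {E : Type*} [NormedAddCommGroup E] [InnerProductSpace ℝ E] [FiniteDimensional ℝ E]
  [MeasurableSpace E] [BorelSpace E]

variable (E) in
/-- The measure on `E` whose radial part is `ρ` and whose spherical part is the surface measure:
the image of `ρ × sphereMeasure E` under `(r, x) ↦ r • x`. -/
noncomputable def radialMeasure (ρ : Measure ℝ) : Measure E :=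
  (ρ.prod (sphereMeasure E)).map fun p => p.1 • p.2

instance (ρ : Measure ℝ) [IsFiniteMeasure ρ] : IsFiniteMeasure (radialMeasure E ρ) :=
  Measure.isFiniteMeasure_map _ _

lemma radialMeasure_mem_compactMeasuresOn [Nontrivial E] {R : Set ℝ} {ρ : Measure ℝ}
    (hρ : ρ ∈ compactMeasuresOn R) :
    radialMeasure E ρ ∈ compactMeasuresOn (R • sphere (0 : E) 1) := by
  obtain ⟨hfin, h0, K, hK, hKR, hae⟩ := mem_compactMeasuresOn_iff.1 hρ
  have hsmul : Measurable fun p : ℝ × E => p.1 • p.2 := by fun_prop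
  have hKS : IsCompact (K • sphere (0 : E) 1) := hK.smul_set (isCompact_sphere 0 1)
  refine mem_compactMeasuresOn_iff.2 ⟨inferInstance, ?_, _, hKS, smul_subset_smul_right hKR, ?_⟩
  · rw [radialMeasure, Ne, Measure.map_eq_zero_iff hsmul.aemeasurable,
      ← Measure.measure_univ_eq_zero, ← univ_prod_univ, Measure.prod_prod, mul_eq_zero,
      Measure.measure_univ_eq_zero, Measure.measure_univ_eq_zero]
    exact not_or.2 ⟨h0, sphereMeasure_ne_zero⟩
  · refine (ae_map_iff hsmul.aemeasurable hKS.isClosed.measurableSet).2 ?_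
    filter_upwards [Measure.quasiMeasurePreserving_fst.ae hae,
      Measure.quasiMeasurePreserving_snd.ae ae_mem_sphere_sphereMeasure] with p hp hp'
    exact smul_mem_smul hp hp'

lemma measureFourier_radialMeasure (ρ : Measure ℝ) [IsFiniteMeasure ρ] (ξ : E) :
    measureFourier (radialMeasure E ρ) ξ = ∫ r, measureFourier (sphereMeasure E) (r • ξ) ∂ρ := by
  have hsmul : Measurable fun p : ℝ × E => p.1 • p.2 := by fun_prop
  have hint : Integrable (fun p : ℝ × E => Complex.exp (-2 * π * Complex.I * inner ℝ (p.1 • p.2) ξ))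
      (ρ.prod (sphereMeasure E)) :=
    .of_bound (Continuous.aestronglyMeasurable (by fun_prop)) 1
      (.of_forall fun p => (norm_cexp_mul_ofReal (by simp) _).le)
  rw [measureFourier, radialMeasure, integral_map hsmul.aemeasurable
    (Continuous.aestronglyMeasurable (by fun_prop)), integral_prod _ hint]
  simp only [measureFourier, real_inner_smul_left, real_inner_smul_right]

lemma measureFourier_radialMeasure_withDensity {μ : Measure ℝ} {f : ℝ → ℝ}
    [IsFiniteMeasure (μ.withDensity fun r => ENNReal.ofReal (f r))] (hf : Measurable f)
    (hf_nonneg : ∀ᵐ r ∂μ, 0 ≤ f r) (ξ : E) :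
    measureFourier (radialMeasure E (μ.withDensity fun r => ENNReal.ofReal (f r))) ξ =
      ∫ r, f r * measureFourier (sphereMeasure E) (r • ξ) ∂μ := by
  rw [measureFourier_radialMeasure, integral_withDensity_eq_integral_toReal_smul
    hf.ennreal_ofReal (.of_forall fun r => ENNReal.ofReal_lt_top)]
  refine integral_congr_ae (hf_nonneg.mono fun r hr => ?_)
  simp only [ENNReal.toReal_ofReal hr, Complex.real_smul]

lemma norm_rpow_mul_measureFourier_radialMeasure {μ : Measure ℝ} {m : ℝ}
    [IsFiniteMeasure (μ.withDensity fun r => ENNReal.ofReal (r ^ m))] (hμ : ∀ᵐ r ∂μ, 0 < r)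
    (ξ : E) :
    ((‖ξ‖ ^ m : ℝ) : ℂ) *
        measureFourier (radialMeasure E (μ.withDensity fun r => ENNReal.ofReal (r ^ m))) ξ =
      ∫ r, ((‖r • ξ‖ ^ m : ℝ) : ℂ) * measureFourier (sphereMeasure E) (r • ξ) ∂μ := by
  rw [measureFourier_radialMeasure_withDensity (by fun_prop)
    (hμ.mono fun r hr => Real.rpow_nonneg hr.le m), ← integral_const_mul]
  refine integral_congr_ae (hμ.mono fun r hr => ?_)
  simp only [norm_smul, Real.norm_of_nonneg hr.le, Real.mul_rpow hr.le (norm_nonneg ξ)]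
  push_cast
  ring

lemma exists_norm_rpow_mul_measureFourier_sphereMeasure_smul_sub_le [Nontrivial E] {K : Set ℝ}
    (hK : IsCompact K) (hKpos : ∀ r ∈ K, 0 < r) :
    ∃ (A B : ℂ) (C : ℝ), ∀ᶠ ξ : E in cobounded E, ∀ r ∈ K,
      ‖((‖r • ξ‖ ^ (((finrank ℝ E : ℝ) - 1) / 2) : ℝ) : ℂ) *
          measureFourier (sphereMeasure E) (r • ξ) -
        (A * Complex.exp (-2 * π * Complex.I * inner ℝ r ‖ξ‖) +
          B * Complex.exp (-2 * π * Complex.I * inner ℝ r (-‖ξ‖)))‖ ≤ C * ‖ξ‖ ^ (-1 : ℝ) := by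
  obtain ⟨a, ha, hKa⟩ := hK.exists_forall_le' continuousOn_id hKpos
  obtain ⟨A, B, C, hABC⟩ := exists_norm_rpow_mul_measureFourier_sub_exponentials_le_div
    (E := E) measurePreserving_sphereMeasure ae_mem_sphere_sphereMeasure
  refine ⟨A, B, |C| / a, ?_⟩
  filter_upwards [eventually_cobounded_le_norm (1 / a), eventually_cobounded_le_norm 1]
    with ξ hξa hξ1 r hr
  have hξ : 0 < ‖ξ‖ := one_pos.trans_le hξ1
  have hnorm : ‖r • ξ‖ = r * ‖ξ‖ := by rw [norm_smul, Real.norm_of_nonneg (hKpos r hr).le]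
  have hle : a * ‖ξ‖ ≤ ‖r • ξ‖ := by
    rw [hnorm]
    exact mul_le_mul_of_nonneg_right (hKa r hr) hξ.le
  have hone : 1 ≤ ‖r • ξ‖ := ((div_le_iff₀' ha).1 hξa).trans hle
  calc _ = ‖((‖r • ξ‖ ^ (((finrank ℝ E : ℝ) - 1) / 2) : ℝ) : ℂ) *
          measureFourier (sphereMeasure E) (r • ξ) -
        (A * Complex.exp (-2 * π * Complex.I * ‖r • ξ‖) +
          B * Complex.exp (2 * π * Complex.I * ‖r • ξ‖))‖ := by
        simp only [hnorm, RCLike.inner_apply, conj_trivial, mul_comm r, Complex.ofReal_neg,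
          mul_neg, neg_mul, neg_neg]
    _ ≤ C / ‖r • ξ‖ := hABC _ hone
    _ ≤ |C| / (a * ‖ξ‖) := div_le_div₀ (abs_nonneg C) (le_abs_self C) (by positivity) hle
    _ = |C| / a * ‖ξ‖ ^ (-1 : ℝ) := by rw [Real.rpow_neg_one, div_mul_eq_div_div, div_eq_mul_inv]

lemma exists_isBigO_measureFourier_radialMeasure [Nontrivial E] {R : Set ℝ} (hR : R ⊆ Ioi 0)
    {μ : Measure ℝ} (hμ : μ ∈ compactMeasuresOn R) {m : ℝ} (hm : m = (finrank ℝ E - 1) / 2)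
    [IsFiniteMeasure (μ.withDensity fun r => ENNReal.ofReal (r ^ m))] :
    ∃ A B : ℂ, (fun ξ : E => ((‖ξ‖ ^ m : ℝ) : ℂ) *
      measureFourier (radialMeasure E (μ.withDensity fun r => ENNReal.ofReal (r ^ m))) ξ -
        (A * measureFourier μ ‖ξ‖ + B * measureFourier μ (-‖ξ‖))) =O[cobounded E]
      fun ξ => ‖ξ‖ ^ (-1 : ℝ) := by
  obtain ⟨hfin, -, K, hK, hKR, hae⟩ := mem_compactMeasuresOn_iff.1 hμ
  have hKpos : ∀ r ∈ K, 0 < r := fun r hr => hR (hKR hr)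
  have hm_nonneg : 0 ≤ m := by
    have hd : (1 : ℝ) ≤ finrank ℝ E := mod_cast finrank_pos (R := ℝ) (M := E)
    linarith
  have hint : ∀ f : ℝ → ℂ, Continuous f → Integrable f μ := fun f hf =>
    integrable_of_continuous_of_ae_mem_isCompact hK hae hf
  obtain ⟨A, B, C, hABC⟩ :=
    exists_norm_rpow_mul_measureFourier_sphereMeasure_smul_sub_le (E := E) hK hKpos
  rw [← hm] at hABC
  refine ⟨A, B, .of_bound (C * μ.real univ) (hABC.mono fun ξ hξ => ?_)⟩
  have hpow : Continuous fun r : ℝ =>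
      ((‖r • ξ‖ ^ m : ℝ) : ℂ) * measureFourier (sphereMeasure E) (r • ξ) :=
    (Complex.continuous_ofReal.comp ((Real.continuous_rpow_const hm_nonneg).comp (by fun_prop))).mul
      ((continuous_measureFourier _).comp (by fun_prop))
  have hexp : ∫ r, (A * Complex.exp (-2 * π * Complex.I * inner ℝ r ‖ξ‖) +
      B * Complex.exp (-2 * π * Complex.I * inner ℝ r (-‖ξ‖))) ∂μ =
        A * measureFourier μ ‖ξ‖ + B * measureFourier μ (-‖ξ‖) := by
    rw [integral_add (hint _ (by fun_prop)) (hint _ (by fun_prop)), integral_const_mul,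
      integral_const_mul, measureFourier, measureFourier]
  rw [norm_rpow_mul_measureFourier_radialMeasure (hae.mono hKpos), ← hexp,
    ← integral_sub (hint _ hpow) (hint _ (by fun_prop)), Real.norm_of_nonneg (by positivity)]
  exact (norm_integral_le_of_norm_le_const (hae.mono hξ)).trans_eq (by ring)

lemma isBigO_measureFourier_radialMeasure [Nontrivial E] {R : Set ℝ} (hR : R ⊆ Ioi 0)
    {μ : Measure ℝ} (hμ : μ ∈ compactMeasuresOn R) {m : ℝ} (hm : m = (finrank ℝ E - 1) / 2)
    [IsFiniteMeasure (μ.withDensity fun r => ENNReal.ofReal (r ^ m))] {s : ℝ} (hs : s ≤ 1)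
    (hdecay : measureFourier μ =O[cobounded ℝ] fun t => ‖t‖ ^ (-s)) :
    measureFourier (radialMeasure E (μ.withDensity fun r => ENNReal.ofReal (r ^ m)))
      =O[cobounded E] fun ξ => ‖ξ‖ ^ (-(s + m)) := by
  obtain ⟨A, B, hAB⟩ := exists_isBigO_measureFourier_radialMeasure hR hμ hm
  have hnorm : Tendsto (fun ξ : E => ‖ξ‖) (cobounded E) (cobounded ℝ) :=
    tendsto_norm_cobounded_atTop.mono_right IsOrderBornology.atTop_le_cobounded
  have hpos : (fun ξ : E => measureFourier μ ‖ξ‖) =O[cobounded E] fun ξ => ‖ξ‖ ^ (-s) := by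
    simpa only [Function.comp_def, norm_norm] using hdecay.comp_tendsto hnorm
  have hneg : (fun ξ : E => measureFourier μ (-‖ξ‖)) =O[cobounded E] fun ξ => ‖ξ‖ ^ (-s) := by
    simpa only [Function.comp_def, norm_neg, norm_norm] using
      hdecay.comp_tendsto (tendsto_neg_cobounded.comp hnorm)
  have hsum := ((hpos.const_mul_left A).add (hneg.const_mul_left B)).add
    (hAB.trans (isBigO_norm_rpow_cobounded (neg_le_neg hs)))
  simp only [add_sub_cancel] at hsum
  have hrpow : (fun ξ : E => ((‖ξ‖ ^ (-m) : ℝ) : ℂ)) =O[cobounded E] fun ξ => ‖ξ‖ ^ (-m) :=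
    Complex.isBigO_ofReal_left.2 (isBigO_refl _ _)
  refine (hrpow.mul hsum).congr' ?_ ?_
  all_goals filter_upwards [eventually_cobounded_le_norm 1] with ξ hξ
  · rw [← mul_assoc, ← Complex.ofReal_mul, ← Real.rpow_add (by linarith), neg_add_cancel,
      Real.rpow_zero, Complex.ofReal_one, one_mul]
  · rw [← Real.rpow_add (by linarith), neg_add_rev]

end RadialMeasure

section LowerBound

variable {E : Type*} [NormedAddCommGroup E] [InnerProductSpace ℝ E] [FiniteDimensional ℝ E]
  [MeasurableSpace E] [BorelSpace E] [Nontrivial E]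

lemma fourierDim_add_finrank_sub_one_le {R : Set ℝ} (hRne : R.Nonempty) (hR : R ⊆ Ioi 0) :
    fourierDim R + (finrank ℝ E - 1) ≤ fourierDim (R • sphere (0 : E) 1) := by
  have hd : (1 : ℝ) ≤ finrank ℝ E := mod_cast finrank_pos (R := ℝ) (M := E)
  let m : ℝ := (finrank ℝ E - 1) / 2
  have hpow : Continuous fun r : ℝ => r ^ m :=
    Real.continuous_rpow_const (div_nonneg (by linarith) zero_le_two)
  refine le_sub_iff_add_le.1 (fourierDim_le hRne fun s hs hs_le μ hμ hdecay => ?_)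
  rw [finrank_self, Nat.cast_one] at hs_le
  have hρ := withDensity_mem_compactMeasuresOn hμ hpow.measurable hpow.continuousOn
    fun r hr => Real.rpow_pos_of_pos (hR hr) m
  have := hρ.1
  have hν := isBigO_measureFourier_radialMeasure (E := E) hR hμ rfl (by linarith) hdecay
  refine le_sub_iff_add_le.2 (le_fourierDim (radialMeasure_mem_compactMeasuresOn hρ)
    (by linarith) (by linarith) ?_)
  rwa [add_div]

end LowerBound

theorem mainTheorem4_general {E : Type*} [NormedAddCommGroup E] [InnerProductSpace ℝ E]
    [FiniteDimensional ℝ E] [Nontrivial E] [MeasurableSpace E] [BorelSpace E] {R : Set ℝ}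
    (hR : R.Nonempty) (hRpos : R ⊆ Ioi 0) :
    fourierDim R + fourierDim (sphere (0 : E) 1) ≤ fourierDim (R • sphere (0 : E) 1) ∧
      fourierDim R + ((finrank ℝ E : ℝ) - 1) ≤ fourierDim (R • sphere (0 : E) 1) := by
  have h := fourierDim_add_finrank_sub_one_le (E := E) hR hRpos
  exact ⟨(add_le_add_right fourierDim_sphere_le _).trans h, h⟩

theorem mainTheorem4 (d : ℕ) (hd : 1 ≤ d) (R : Set ℝ) (hR : R.Nonempty) (hRc : IsCompact R)
    (hRpos : R ⊆ Set.Ioi 0) :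
    fourierDim R + fourierDim (Metric.sphere (0 : EuclideanSpace ℝ (Fin d)) 1) ≤
        fourierDim (R • Metric.sphere (0 : EuclideanSpace ℝ (Fin d)) 1) ∧
      fourierDim R + ((d : ℝ) - 1) ≤
        fourierDim (R • Metric.sphere (0 : EuclideanSpace ℝ (Fin d)) 1) := by
  have : NeZero d := ⟨by lia⟩
  simpa using mainTheorem4_general (E := EuclideanSpace ℝ (Fin d)) hR hRpos
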